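/- **Model.** Consider $N$ switches in slotted time $t=0,1,2,\dots$, a finite set $\mathcal S\subseteq\{0,1\}^{N\times N}$ of feasible schedules, a reconfiguration delay $\Delta_r>0$, an arbitrary initial schedule $\mathbf S(-1)\in\mathcal S$ and arbitrary initial queue lengths $\mathbf L(0)\in\mathbb N^{N\times N}$ with $L_{ii}(0)=0$. If $\mathbf S(t)\in\mathcal S$ is the schedule and $\mathbf A(t)\in\mathbb N^{N\times N}$ the arrivals in slot $t$, then $L_{ij}(t+1)=L_{ij}(t)-D_{ij}(t)+A_{ij}(t)$, where $D_{ij}(t)=0$ for all $i,j$ if $k\le t\le k+\Delta_r$ for some slot $k$ with $\mathbf S(k)\ne\mathbf S(k-1)$, and otherwise $D_{ij}(t)=S_{ij}(t)$ if $L_{ij}(t)>0$ and $D_{ij}(t)=0$ if $L_{ij}(t)=0$. The processes $A_{ij}$, $i\neq j$, are independent, each is i.i.d. over time with finite mean $\lambda_{ij}$, and $A_{ii}=0$. A scheduling policy chooses $\mathbf S(t)\in\mathcal S$ as a function of $\mathbf A(0),\dots,\mathbf A(t),\mathbf S(0),\dots,\mathbf S(t-1)$. It strongly stabilizes the network if $\limsup_{t\to\infty}\frac1t\sum_{\tau<t}\mathbb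 E\big[\sum_{i,j}L_{ij}(\tau)\big]<\infty$. Traffic is admissible if some scheduling policy strongly stabilizes the network under it; $\Lambda$ is the set of the rate matrices $\boldsymbol\lambda$ of admissible traffic, and the load of $\boldsymbol\lambda$ is $\rho=\inf\{r\in(0,1):\boldsymbol\lambda\in r\bar\Lambda\}$ ($=\infty$ if there is no such $r$). A policy is throughput optimal if it strongly stabilizes the network under all admissible traffic with bounded arrivals ($A_{ij}(t)\le A_{\max}<\infty$) and load $\rho<1$. The weight of $\mathbf S\in\mathcal S$ at time $t$ is $W_{\mathbf S}(t)=\sum_{i,j}L_{ij}(t)S_{ij}$, and $W^*(t)=\max_{\mathbf S\in\mathcal S}W_{\mathbf S}(t)$. A hysteresis function $g$ is nonnegative, continuous and strictly increasing on $[0,\infty)$, with $g(x)/x\to0$ and $g(x)\to\infty$ as $x\to\infty$. If a policy $\pi$ proposes the schedule $\mathbf\Pi(t)$, with weight $W^\pi(t)=W_{\mathbf\Pi(t)}(t)$, its $g$-adaptive variant uses $\mathbf S(t)=\mathbf S(t-1)$ if $W^\pi(t)-W_{\mathbf S(t-1)}(t)\le g(W^\pi(t))$, and $\mathbf S(t)=\mathbf\Pi(t)$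 otherwise. The MaxWeight policy proposes a schedule of maximum weight at time $t$; the pipelined MaxWeight policy with lag $K\in\mathbb N$ proposes at time $t$ a schedule of maximum weight at time $\max(t-K,0)$ (ties are broken arbitrarily). **Corollary.** For every reconfiguration delay $\Delta_r>0$: (a) for all $\gamma,\delta\in(0,1)$, the Adaptive MaxWeight policy, i.e. the $g$-adaptive variant of MaxWeight with $g(x)=(1-\gamma)x^{1-\delta}$, is throughput optimal; (b) for every $K\in\mathbb N$ and every hysteresis function $g$, the $g$-adaptive variant of the pipelined MaxWeight policy with lag $K$ is throughput optimal; moreover, if every feasible schedule has at most one entry $1$ in each row and in each column, then the schedules proposed by pipelined MaxWeight satisfy $W^\pi(t)\ge W^*(t)-G$ for all $t$ with $G=N(A_{\max}+1)K$, for all arrivals bounded by $A_{\max}$ and whichever schedules are employed in the network (in particular under its $g$-adaptive variant). -/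

import Mathlib

open MeasureTheory ProbabilityTheory Filter Topology
open scoped ENNReal NNReal Pointwise

universe u

namespace OpticalSwitch

/-- An `N × N` matrix of packet counts (queue lengths or arrivals). -/
abbrev Counts (N : ℕ) := Fin N → Fin N → ℕ

/-- A bufferless optical network with `N` top-of-rack switches: the set of feasible schedules
(`0/1`-matrices), the reconfiguration delay, the schedule `S(-1)` in force before slot `0` and
the queue lengths `L(0)`. There is no queue from a switch to itself. -/
structure Network (N : ℕ) where
  feasible : Finset (Fin N → Fin N → Bool)
  delay : ℝ
  initSchedule : {S : Fin N → Fin N → Bool // S ∈ feasible}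
  initQueue : Counts N
  initQueue_self : ∀ i, initQueue i i = 0

variable {N : ℕ}

/-- The feasible schedules of a network. -/
abbrev Network.Schedule (net : Network N) := {S : Fin N → Fin N → Bool // S ∈ net.feasible}

/-- Each switch transmits to at most one switch and receives from at most one switch. -/
def Network.IsCrossbar (net : Network N) : Prop :=
  ∀ S ∈ net.feasible, (∀ i, ∑ j, (S i j).toNat ≤ 1) ∧ (∀ j, ∑ i, (S i j).toNat ≤ 1)

/-- The weight `⟨L, S⟩` of a schedule. -/
def weight (L : Counts N) (S : Fin N → Fin N → Bool) : ℕ :=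
  ∑ i, ∑ j, L i j * (S i j).toNat

/-- The maximum weight `W*` over the feasible schedules. -/
def maxWeight (net : Network N) (L : Counts N) : ℕ :=
  net.feasible.sup (weight L)

/-- The schedule `S(t-1)` of the previous slot. -/
def prevSchedule (net : Network N) (s : ℕ → net.Schedule) : ℕ → net.Schedule
  | 0 => net.initSchedule
  | t + 1 => s t

/-- Slot `t` lies within `k, …, k + Δ_r` for some slot `k` at which the schedule changed. -/
def Reconfiguring (net : Network N) (s : ℕ → net.Schedule) (t : ℕ) : Prop :=
  ∃ k ≤ t, s k ≠ prevSchedule net s k ∧ (t : ℝ) ≤ (k : ℝ) + net.delay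

open Classical in
/-- The departures `D(t)` in slot `t` when the queue lengths at its beginning are `L`. -/
noncomputable def departures (net : Network N) (s : ℕ → net.Schedule) (t : ℕ) (L : Counts N) :
    Counts N :=
  fun i j =>
    if Reconfiguring net s t then 0 else if 0 < L i j then ((s t).1 i j).toNat else 0

/-- The queue lengths `L(t)`, when the schedules are `s` and the arrivals are `a`:
`L(t+1) = L(t) - D(t) + A(t)` (the subtraction never truncates). -/
noncomputable def queue (net : Network N) (s : ℕ → net.Schedule) (a : ℕ → Counts N) :
    ℕ → Counts N
  | 0 => net.initQueue
  | t + 1 => fun i j =>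
      queue net s a t i j - departures net s t (queue net s a t) i j + a t i j

/-- A scheduling policy: the schedule `S(t)` is a function of the arrivals `A(0), …, A(t)` and
the schedules `S(0), …, S(t-1)`. All these objects take countably many values, so this is the
same as measurability with respect to the history. -/
structure Policy (net : Network N) where
  rule : ℕ → (ℕ → Counts N) → (ℕ → net.Schedule) → net.Schedule
  causal : ∀ t a a' s s', (∀ τ ≤ t, a τ = a' τ) → (∀ τ < t, s τ = s' τ) →
    rule t a s = rule t a' s'

/-- The schedules `S(t)` that a policy produces on the arrivals `a`. -/
def Policy.run {net : Network N} (p : Policy net) (a : ℕ → Counts N) (t : ℕ) : net.Schedule :=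
  p.rule t a (fun τ => if _h : τ < t then p.run a τ else net.initSchedule)
termination_by t

theorem prevSchedule_congr (net : Network N) {s s' : ℕ → net.Schedule} {t : ℕ}
    (h : ∀ τ < t, s τ = s' τ) : prevSchedule net s t = prevSchedule net s' t := by
  cases t with
  | zero => rfl
  | succ t => exact h t (Nat.lt_succ_self t)

theorem reconfiguring_congr (net : Network N) {s s' : ℕ → net.Schedule} {t : ℕ}
    (h : ∀ τ ≤ t, s τ = s' τ) : Reconfiguring net s t ↔ Reconfiguring net s' t := by
  unfold Reconfiguring
  refine exists_congr fun k => and_congr_right fun hk => ?_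
  rw [h k hk, prevSchedule_congr net (fun τ hτ => h τ (by omega))]

theorem queue_congr (net : Network N) {s s' : ℕ → net.Schedule} {a a' : ℕ → Counts N} {t : ℕ}
    (hs : ∀ τ < t, s τ = s' τ) (ha : ∀ τ < t, a τ = a' τ) :
    queue net s a t = queue net s' a' t := by
  induction t with
  | zero => rfl
  | succ t ih =>
    have e := ih (fun τ h => hs τ (by omega)) (fun τ h => ha τ (by omega))
    have hr := reconfiguring_congr net (fun τ (h : τ ≤ t) => hs τ (by omega))
    funext i j
    by_cases h : Reconfiguring net s' t <;>
      simp [queue, departures, e, hr, h, hs t (Nat.lt_succ_self t), ha t (Nat.lt_succ_self t)]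

open Classical in
/-- The `g`-adaptive variant of `p`: keep the previous schedule if
`W^π(t) - W_{S(t-1)}(t) ≤ g (W^π(t))`, and otherwise use the schedule proposed by `p`. -/
noncomputable def Policy.adaptive {net : Network N} (g : ℝ → ℝ) (p : Policy net) :
    Policy net where
  rule t a s :=
    if (weight (queue net s a t) (p.rule t a s).1 : ℝ)
        - (weight (queue net s a t) (prevSchedule net s t).1 : ℝ)
        ≤ g (weight (queue net s a t) (p.rule t a s).1 : ℝ)
    then prevSchedule net s t else p.rule t a s
  causal t a a' s s' ha hs := by
    rw [p.causal t a a' s s' ha hs, prevSchedule_congr net hs,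
      queue_congr net hs (fun τ h => ha τ h.le)]

/-- `p` always proposes a schedule of maximum weight (ties are broken in any way). -/
def Policy.IsMaxWeight {net : Network N} (p : Policy net) : Prop :=
  ∀ t a s, weight (queue net s a t) (p.rule t a s).1 = maxWeight net (queue net s a t)

/-- `p` always proposes a schedule that maximizes the weight at time `t - K` (at time `0` as
long as `t < K`; ties are broken in any way). -/
def Policy.IsPipelinedMaxWeight {net : Network N} (K : ℕ) (p : Policy net) : Prop :=
  ∀ t a s, weight (queue net s a (t - K)) (p.rule t a s).1 =
    maxWeight net (queue net s a (t - K))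

/-- `W^π(t) ≥ W*(t) - G` for all `t`, for the schedules proposed by `p`, whichever schedules are
employed in the network (those of `p` itself, or those of an adaptive variant, for example) and
for all arrivals bounded by `Amax`. -/
def Policy.WeightGapAtMost {net : Network N} (p : Policy net) (Amax : ℕ) (G : ℝ) : Prop :=
  ∀ (a : ℕ → Counts N) (s : ℕ → net.Schedule), (∀ t i j, a t i j ≤ Amax) →
    ∀ t, (weight (queue net s a t) (p.rule t a s).1 : ℝ) ≥ maxWeight net (queue net s a t) - G

/-- A hysteresis function. Weights are nonnegative, so only its values on `[0, ∞)` matter. -/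
structure IsHysteresis (g : ℝ → ℝ) : Prop where
  nonneg : ∀ x, 0 ≤ x → 0 ≤ g x
  continuousOn : ContinuousOn g (Set.Ici 0)
  strictMonoOn : StrictMonoOn g (Set.Ici 0)
  sublinear : Tendsto (fun x => g x / x) atTop (𝓝 0)
  unbounded : Tendsto g atTop atTop

section Traffic

variable {Ω : Type u} [MeasurableSpace Ω]

/-- Arrival traffic: the processes `A_ij` are independent, each is i.i.d. over the slots and has
a finite mean, and there is no traffic from a switch to itself. -/
structure IsTraffic (P : Measure Ω) (A : ℕ → Ω → Counts N) : Prop where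
  measurable : ∀ t i j, Measurable fun ω => A t ω i j
  indep : iIndepFun (fun (p : ℕ × Fin N × Fin N) (ω : Ω) => A p.1 ω p.2.1 p.2.2) P
  identDistrib : ∀ t i j, IdentDistrib (fun ω => A t ω i j) (fun ω => A 0 ω i j) P P
  integrable : ∀ i j, Integrable (fun ω => (A 0 ω i j : ℝ)) P
  self : ∀ t ω i, A t ω i i = 0

/-- The traffic rate matrix. -/
noncomputable def rate (P : Measure Ω) (A : ℕ → Ω → Counts N) : Fin N → Fin N → ℝ :=
  fun i j => ∫ ω, (A 0 ω i j : ℝ) ∂P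

/-- The total queue length `‖L(t)‖` under the policy `p` and arrivals `a`. -/
noncomputable def totalQueue {net : Network N} (p : Policy net) (a : ℕ → Counts N) (t : ℕ) : ℕ :=
  ∑ i, ∑ j, queue net (p.run a) a t i j

/-- The time average of the expected total queue length has a finite limit superior. -/
def StronglyStable {net : Network N} (p : Policy net) (P : Measure Ω) (A : ℕ → Ω → Counts N) :
    Prop :=
  limsup (fun t : ℕ => (∑ τ ∈ Finset.range t,
    ∫⁻ ω, (totalQueue p (fun t' => A t' ω) τ : ℝ≥0∞) ∂P) / (t : ℝ≥0∞)) atTop < ⊤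

/-- Some scheduling policy strongly stabilizes the network under the traffic. -/
def Admissible (net : Network N) (P : Measure Ω) (A : ℕ → Ω → Counts N) : Prop :=
  ∃ p : Policy net, StronglyStable p P A

end Traffic

/-- The capacity region: the rate matrices of admissible traffic. -/
def capacityRegion (net : Network N) : Set (Fin N → Fin N → ℝ) :=
  {l | ∃ (Ω : Type) (_ : MeasurableSpace Ω) (P : Measure Ω) (A : ℕ → Ω → Counts N),
    IsProbabilityMeasure P ∧ IsTraffic P A ∧ Admissible net P A ∧ rate P A = l}

/-- The load `ρ` of a rate matrix: the infimum of the `r ∈ (0, 1)` such that the matrix lies in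
`r` times the closure of the capacity region (`∞` if there is no such `r`). -/
noncomputable def load (net : Network N) (l : Fin N → Fin N → ℝ) : ℝ≥0∞ :=
  ⨅ (r : ℝ≥0) (_ : 0 < r ∧ r < 1 ∧ l ∈ (r : ℝ) • closure (capacityRegion net)), (r : ℝ≥0∞)

/-- Throughput optimality: the policy strongly stabilizes the network under all admissible
traffic, for traffic with bounded arrivals and load `ρ < 1`. -/
def ThroughputOptimal {net : Network N} (p : Policy net) : Prop :=
  ∀ (Ω : Type u) (_ : MeasurableSpace Ω) (P : Measure Ω) (A : ℕ → Ω → Counts N),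
    IsProbabilityMeasure P → IsTraffic P A → (∃ Amax : ℕ, ∀ t ω i j, A t ω i j ≤ Amax) →
    Admissible net P A → load net (rate P A) < 1 → StronglyStable p P A

end OpticalSwitch

open OpticalSwitch

namespace OpticalSwitch

/-! ### Queue dynamics along one arrival path, and the weight gap of stale proposals. -/

section Pathwise

variable {N : ℕ} {net : Network N}

/-! The Lyapunov function is the sum of the squared queue lengths. Its drift is summed along each
bounded arrival path, and expectations are taken only at the end, so no Markov chain or stationary
law is needed.

Service: outside reconfiguration, ⟨L, D⟩ is the weight of the current schedule. Since `g` is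
sublinear and the proposals are within a constant of W*, this weight is at least (1 - ε)W* minus a
constant. Reconfigurations cost little: soon after a switch the weight deficit is still bounded, so
a second switch would need `g` of the proposed weight to be bounded, hence W* to be bounded.
Switches at large W* are therefore preceded by M quiet slots, and as W* grows at most linearly, the
total W* at switches is at most 1/M of the overall total, up to a linear term (`sum_marked_le`).
Large M makes the loss negligible (`exists_sum_maxWeight_le_departures`), and the quadratic drift
turns this into (1 - ε) Σ W* ≤ Σ ⟨L, A⟩ + C(T + 1) (`exists_sum_maxWeight_le_arrivals`).

Arrivals: every admissible rate matrix λ satisfies ⟨w, λ⟩ ≤ W*(w) for all integer weights w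
(`Admissible.sum_mul_rate_le`). Load below 1 improves this by a factor r < 1. As L(t) is independent
of A(t), E⟨L, A⟩ ≤ r E W*, which bounds the time averages of E W*. Finally W* controls all queues
almost surely, since a queue that no schedule serves gets no traffic (`ae_queue_le_maxWeight_add`).
-/

theorem weight_le_maxWeight (L : Counts N) (S : net.Schedule) :
    weight L S.1 ≤ maxWeight net L :=
  Finset.le_sup (f := weight L) S.2

theorem departures_le_toNat (s : ℕ → net.Schedule) (t : ℕ) (L : Counts N) (i j : Fin N) :
    departures net s t L i j ≤ ((s t).1 i j).toNat := by
  unfold departures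
  split_ifs <;> simp

theorem departures_le_queue (s : ℕ → net.Schedule) (t : ℕ) (L : Counts N) (i j : Fin N) :
    departures net s t L i j ≤ L i j := by
  unfold departures
  split_ifs with h1 h2
  · simp
  · exact (Bool.toNat_le _).trans h2
  · simp

theorem queue_succ_add_departures (s : ℕ → net.Schedule) (a : ℕ → Counts N) (t : ℕ)
    (i j : Fin N) :
    queue net s a (t + 1) i j + departures net s t (queue net s a t) i j
      = queue net s a t i j + a t i j := by
  have := departures_le_queue s t (queue net s a t) i j
  simp only [queue]
  omega

theorem queue_add_arrivals_le (s : ℕ → net.Schedule) (a : ℕ → Counts N) (t : ℕ) (i j : Fin N) :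
    queue net s a t i j + a t i j ≤ queue net s a (t + 1) i j + ((s t).1 i j).toNat := by
  have h1 := queue_succ_add_departures s a t i j
  have h2 := departures_le_toNat s t (queue net s a t) i j
  omega

/-- Service wasted on an empty queue is invisible here, since that queue has coefficient 0. -/
theorem weight_departures (s : ℕ → net.Schedule) (t : ℕ) (L : Counts N)
    (h : ¬ Reconfiguring net s t) :
    ∑ i, ∑ j, L i j * departures net s t L i j = weight L (s t).1 := by
  unfold weight departures
  refine Finset.sum_congr rfl fun i _ => Finset.sum_congr rfl fun j _ => ?_
  rw [if_neg h]
  split_ifs with h2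
  · rfl
  · simp [Nat.eq_zero_of_not_pos h2]

theorem weight_queue_succ_le {n Amax : ℕ} {S : Fin N → Fin N → Bool}
    (hS : ∑ i, ∑ j, (S i j).toNat ≤ n) (s : ℕ → net.Schedule) {a : ℕ → Counts N}
    (ha : ∀ t i j, a t i j ≤ Amax) (t : ℕ) :
    weight (queue net s a (t + 1)) S ≤ weight (queue net s a t) S + n * Amax := by
  calc weight (queue net s a (t + 1)) S
      ≤ ∑ i, ∑ j, (queue net s a t i j * (S i j).toNat + (S i j).toNat * Amax) := by
        refine Finset.sum_le_sum fun i _ => Finset.sum_le_sum fun j _ => ?_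
        have h1 := queue_succ_add_departures s a t i j
        have h2 := ha t i j
        calc _ ≤ (queue net s a t i j + Amax) * (S i j).toNat :=
              Nat.mul_le_mul_right _ (by omega)
          _ = _ := by ring
    _ = weight (queue net s a t) S + (∑ i, ∑ j, (S i j).toNat) * Amax := by
        simp only [Finset.sum_add_distrib, Finset.sum_mul, weight]
    _ ≤ _ := by gcongr

theorem weight_queue_le_succ {n : ℕ} {S : Fin N → Fin N → Bool}
    (hS : ∑ i, ∑ j, (S i j).toNat ≤ n) (s : ℕ → net.Schedule) (a : ℕ → Counts N) (t : ℕ) :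
    weight (queue net s a t) S ≤ weight (queue net s a (t + 1)) S + n := by
  calc weight (queue net s a t) S
      ≤ ∑ i, ∑ j, (queue net s a (t + 1) i j * (S i j).toNat + (S i j).toNat) := by
        refine Finset.sum_le_sum fun i _ => Finset.sum_le_sum fun j _ => ?_
        have h1 := queue_add_arrivals_le s a t i j
        have h2 := Bool.toNat_le ((s t).1 i j)
        calc _ ≤ (queue net s a (t + 1) i j + 1) * (S i j).toNat :=
              Nat.mul_le_mul_right _ (by omega)
          _ = _ := by ring
    _ = weight (queue net s a (t + 1)) S + ∑ i, ∑ j, (S i j).toNat := by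
        simp only [Finset.sum_add_distrib, weight]
    _ ≤ _ := by gcongr

theorem weight_queue_add_le {n Amax : ℕ} {S : Fin N → Fin N → Bool}
    (hS : ∑ i, ∑ j, (S i j).toNat ≤ n) (s : ℕ → net.Schedule) {a : ℕ → Counts N}
    (ha : ∀ t i j, a t i j ≤ Amax) (t m : ℕ) :
    weight (queue net s a (t + m)) S ≤ weight (queue net s a t) S + n * Amax * m := by
  induction m with
  | zero => simp
  | succ m ih =>
    have := weight_queue_succ_le hS s ha (t + m)
    rw [← add_assoc, mul_add]
    omega

theorem weight_queue_le_add {n : ℕ} {S : Fin N → Fin N → Bool}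
    (hS : ∑ i, ∑ j, (S i j).toNat ≤ n) (s : ℕ → net.Schedule) (a : ℕ → Counts N) (t m : ℕ) :
    weight (queue net s a t) S ≤ weight (queue net s a (t + m)) S + n * m := by
  induction m with
  | zero => simp
  | succ m ih =>
    have := weight_queue_le_succ hS s a (t + m)
    rw [← add_assoc, mul_add]
    omega

theorem maxWeight_queue_add_le {n Amax : ℕ}
    (hn : ∀ S ∈ net.feasible, ∑ i, ∑ j, (S i j).toNat ≤ n) (s : ℕ → net.Schedule)
    {a : ℕ → Counts N} (ha : ∀ t i j, a t i j ≤ Amax) (t m : ℕ) :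
    maxWeight net (queue net s a (t + m)) ≤ maxWeight net (queue net s a t) + n * Amax * m :=
  Finset.sup_le fun S hS => (weight_queue_add_le (hn S hS) s ha t m).trans
    (Nat.add_le_add_right (weight_le_maxWeight _ ⟨S, hS⟩) _)

/-- The proposal is optimal at time `t - K`. In each of the at most `K` slots since then, W* rises
by at most `n * Amax` and the weight of the proposal falls by at most `n`. -/
theorem Policy.IsPipelinedMaxWeight.maxWeight_le {p : Policy net} {K n Amax : ℕ}
    (hp : p.IsPipelinedMaxWeight K)
    (hn : ∀ S ∈ net.feasible, ∑ i, ∑ j, (S i j).toNat ≤ n) (s : ℕ → net.Schedule)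
    {a : ℕ → Counts N} (ha : ∀ t i j, a t i j ≤ Amax) (t : ℕ) :
    maxWeight net (queue net s a t)
      ≤ weight (queue net s a t) (p.rule t a s).1 + n * (Amax + 1) * K := by
  -- The actual lag is min(t, K), because `t - K` truncates at 0.
  obtain ⟨m, hm, hmK⟩ : ∃ m, t - K + m = t ∧ m ≤ K := ⟨t - (t - K), by omega, by omega⟩
  have h1 := maxWeight_queue_add_le hn s ha (t - K) m
  have h2 := weight_queue_le_add (hn _ (p.rule t a s).2) s a (t - K) m
  rw [hm] at h1 h2
  rw [hp t a s] at h2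
  have h3 : n * (Amax + 1) * m ≤ n * (Amax + 1) * K := Nat.mul_le_mul_left _ hmK
  have h4 : n * (Amax + 1) * m = n * Amax * m + n * m := by ring
  omega

theorem Network.IsCrossbar.sum_toNat_le (h : net.IsCrossbar) :
    ∀ S ∈ net.feasible, ∑ i, ∑ j, (S i j).toNat ≤ N := fun S hS =>
  (Finset.sum_le_sum fun i _ => (h S hS).1 i).trans (by simp)

theorem sum_toNat_le_mul (S : Fin N → Fin N → Bool) : ∑ i, ∑ j, (S i j).toNat ≤ N * N :=
  (Finset.sum_le_sum fun i _ => Finset.sum_le_sum fun j _ => Bool.toNat_le (S i j)).trans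
    (by simp)

theorem Policy.IsPipelinedMaxWeight.weightGapAtMost {p : Policy net} {K n : ℕ}
    (hp : p.IsPipelinedMaxWeight K)
    (hn : ∀ S ∈ net.feasible, ∑ i, ∑ j, (S i j).toNat ≤ n) (Amax : ℕ) :
    p.WeightGapAtMost Amax ((n : ℝ) * ((Amax : ℝ) + 1) * (K : ℝ)) := by
  intro a s ha t
  have h : (maxWeight net (queue net s a t) : ℝ)
      ≤ weight (queue net s a t) (p.rule t a s).1 + n * (Amax + 1) * K := by
    exact_mod_cast hp.maxWeight_le hn s ha t
  linarith

theorem Policy.run_eq_rule (p : Policy net) (a : ℕ → Counts N) (t : ℕ) :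
    p.run a t = p.rule t a (p.run a) := by
  rw [Policy.run]
  exact p.causal t _ _ _ _ (fun _ _ => rfl) (fun τ hτ => by simp [hτ])

theorem Policy.run_congr (p : Policy net) {a a' : ℕ → Counts N} (t : ℕ)
    (h : ∀ τ ≤ t, a τ = a' τ) : p.run a t = p.run a' t := by
  induction t using Nat.strong_induction_on with
  | _ t ih =>
    rw [p.run_eq_rule a, p.run_eq_rule a']
    exact p.causal t _ _ _ _ h fun τ hτ => ih τ hτ fun σ hσ => h σ (by omega)

theorem queue_run_congr (p : Policy net) {a a' : ℕ → Counts N} {t : ℕ}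
    (h : ∀ τ < t, a τ = a' τ) :
    queue net (p.run a) a t = queue net (p.run a') a' t :=
  queue_congr net (fun τ hτ => p.run_congr τ fun σ hσ => h σ (by omega)) h

/-! ### Summation estimates for switching and reconfiguring slots. -/

/-- A slowly growing sequence is rarely large at its marked times, if marked times at which it is
large are preceded by a long unmarked period. -/
theorem sum_marked_le (W : ℕ → ℝ) (hW : ∀ t, 0 ≤ W t) (sw : ℕ → Prop) [DecidablePred sw]
    {M : ℕ} (hM : 0 < M) {c C : ℝ} (hc : 0 ≤ c) (hC : 0 ≤ C)
    (hlip : ∀ t m : ℕ, W (t + m) ≤ W t + c * m)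
    (hsw : ∀ k, sw k → W k ≤ C ∨ (M ≤ k ∧ ∀ k', k - M ≤ k' → k' < k → ¬ sw k')) (T : ℕ) :
    ∑ k ∈ Finset.range T, (if sw k then W k else 0)
      ≤ (1 / M) * ∑ t ∈ Finset.range T, W t + (C + c) * T := by
  have hM' : (0 : ℝ) < M := by exact_mod_cast hM
  have hinv : (0 : ℝ) ≤ 1 / M := by positivity
  induction T using Nat.strong_induction_on with
  | _ T ih =>
    rcases T with _ | k
    · simp
    have hmono : (1 / M : ℝ) * ∑ t ∈ Finset.range k, W t
        ≤ (1 / M) * ∑ t ∈ Finset.range (k + 1), W t := by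
      rw [Finset.sum_range_succ, mul_add]
      have := mul_nonneg hinv (hW k)
      linarith
    have ihk := ih k (Nat.lt_succ_self k)
    by_cases hk : sw k
    · rcases hsw k hk with h | ⟨hMk, hno⟩
      · rw [Finset.sum_range_succ, if_pos hk]
        push_cast
        linarith
      -- The window `q, …, q + M` is split off as a block: its first `M` slots contribute nothing on
      -- the left, and their average of `W` bounds `W (q + M)` up to `c * M`.
      · obtain ⟨q, rfl⟩ := Nat.exists_eq_add_of_le' hMk
        have ihq := ih q (by omega)
        have hzero : ∑ x ∈ Finset.range M, (if sw (q + x) then W (q + x) else 0) = 0 :=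
          Finset.sum_eq_zero fun x hx => by
            rw [Finset.mem_range] at hx
            exact if_neg (hno _ (by omega) (by omega))
        have hwin : W (q + M) ≤ (1 / M) * ∑ x ∈ Finset.range M, W (q + x) + c * M := by
          have hsum : ∑ x ∈ Finset.range M, W (q + M)
              ≤ ∑ x ∈ Finset.range M, (W (q + x) + c * M) := by
            refine Finset.sum_le_sum fun x hx => ?_
            rw [Finset.mem_range] at hx
            have h1 := hlip (q + x) (M - x)
            rw [show q + x + (M - x) = q + M by omega] at h1
            have h2 : c * ((M - x : ℕ) : ℝ) ≤ c * M :=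
              mul_le_mul_of_nonneg_left (by exact_mod_cast Nat.sub_le _ _) hc
            linarith
          rw [Finset.sum_add_distrib, Finset.sum_const, Finset.sum_const, Finset.card_range,
            nsmul_eq_mul, nsmul_eq_mul] at hsum
          have := mul_le_mul_of_nonneg_left hsum hinv
          calc W (q + M) = 1 / M * (M * W (q + M)) := by field_simp
            _ ≤ _ := this
            _ = _ := by field_simp
        refine le_trans ?_ (add_le_add_left hmono _)
        rw [Finset.sum_range_succ, if_pos hk, Finset.sum_range_add, Finset.sum_range_add, hzero,
          mul_add]
        push_cast
        have : 0 ≤ C * M := by positivity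
        nlinarith
    · rw [Finset.sum_range_succ, if_neg hk]
      push_cast
      linarith

theorem sum_delayed_le (f : ℕ → ℝ) (hf : ∀ t, 0 ≤ f t) (d T : ℕ) :
    ∑ t ∈ Finset.range T, (if d ≤ t then f (t - d) else 0) ≤ ∑ t ∈ Finset.range T, f t := by
  rcases le_total T d with h | h
  · rw [Finset.sum_eq_zero]
    · exact Finset.sum_nonneg fun t _ => hf t
    · intro t ht
      rw [Finset.mem_range] at ht
      exact if_neg (by omega)
  · obtain ⟨m, rfl⟩ := Nat.exists_eq_add_of_le h
    rw [Finset.sum_range_add, Finset.sum_eq_zero, zero_add]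
    · simp only [Nat.le_add_right, if_true, Nat.add_sub_cancel_left]
      exact Finset.sum_le_sum_of_subset_of_nonneg
        (Finset.range_subset_range.2 (Nat.le_add_left _ _)) fun t _ _ => hf t
    · intro t ht
      rw [Finset.mem_range] at ht
      exact if_neg (by omega)

/-- Each slot in `R` is charged to a marked slot at most `D` earlier, where `W` is smaller by at
most `c * D`. A marked slot is charged at most once for each of the `D + 1` possible delays. -/
theorem sum_near_marked_le (W : ℕ → ℝ) (hW : ∀ t, 0 ≤ W t) (sw R : ℕ → Prop)
    [DecidablePred sw] [DecidablePred R] {c : ℝ} (hc : 0 ≤ c)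
    (hlip : ∀ t m : ℕ, W (t + m) ≤ W t + c * m) (D : ℕ)
    (hR : ∀ t, R t → ∃ k ≤ t, sw k ∧ t ≤ k + D) (T : ℕ) :
    ∑ t ∈ Finset.range T, (if R t then W t else 0)
      ≤ (D + 1) * (∑ k ∈ Finset.range T, (if sw k then W k else 0) + c * D * T) := by
  set f : ℕ → ℝ := fun k => (if sw k then W k else 0) + c * D with hf
  have hf0 : ∀ k, 0 ≤ f k := fun k => by
    have : 0 ≤ c * D := by positivity
    simp only [hf]
    split_ifs
    · linarith [hW k]
    · linarith
  calc ∑ t ∈ Finset.range T, (if R t then W t else 0)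
      ≤ ∑ t ∈ Finset.range T, ∑ d ∈ Finset.range (D + 1),
          (if d ≤ t then f (t - d) else 0) := by
        refine Finset.sum_le_sum fun t _ => ?_
        have hnn : ∀ d ∈ Finset.range (D + 1), 0 ≤ (if d ≤ t then f (t - d) else 0) :=
          fun d _ => by split_ifs <;> simp [hf0]
        split_ifs with h
        · obtain ⟨k, hkt, hk, htD⟩ := hR t h
          refine le_trans ?_ (Finset.single_le_sum hnn
            (Finset.mem_range.2 (show t - k < D + 1 by omega)))
          rw [if_pos (Nat.sub_le _ _), Nat.sub_sub_self hkt]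
          simp only [hf, if_pos hk]
          have h1 := hlip k (t - k)
          rw [Nat.add_sub_cancel' hkt] at h1
          have h2 : c * ((t - k : ℕ) : ℝ) ≤ c * D :=
            mul_le_mul_of_nonneg_left (by exact_mod_cast (by omega)) hc
          linarith
        · exact Finset.sum_nonneg hnn
    _ = ∑ d ∈ Finset.range (D + 1), ∑ t ∈ Finset.range T,
          (if d ≤ t then f (t - d) else 0) := Finset.sum_comm
    _ ≤ ∑ d ∈ Finset.range (D + 1), ∑ t ∈ Finset.range T, f t :=
        Finset.sum_le_sum fun d _ => sum_delayed_le f hf0 d T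
    _ = _ := by
        simp only [hf, Finset.sum_add_distrib, Finset.sum_const, Finset.card_range, nsmul_eq_mul]
        push_cast
        ring

/-! ### Consequences of hysteresis. -/

theorem IsHysteresis.exists_le_add {g : ℝ → ℝ} (hg : IsHysteresis g) {ε : ℝ} (hε : 0 < ε) :
    ∃ C, 0 ≤ C ∧ ∀ x, 0 ≤ x → g x ≤ ε * x + C := by
  obtain ⟨b, hb⟩ := eventually_atTop.1 (hg.sublinear.eventually (gt_mem_nhds hε))
  have hx0 : (0 : ℝ) ≤ max b 1 := zero_le_one.trans (le_max_right _ _)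
  refine ⟨g (max b 1), hg.nonneg _ hx0, fun x hx => ?_⟩
  rcases le_total x (max b 1) with h | h
  · have := hg.strictMonoOn.monotoneOn hx hx0 h
    have : 0 ≤ ε * x := by positivity
    linarith
  · have h1 := hb x ((le_max_left _ _).trans h)
    have hxpos : 0 < x := zero_lt_one.trans_le ((le_max_right _ _).trans h)
    rw [div_lt_iff₀ hxpos] at h1
    linarith [hg.nonneg _ hx0]

theorem IsHysteresis.exists_le_of_le {g : ℝ → ℝ} (hg : IsHysteresis g) (y : ℝ) :
    ∃ C, 0 ≤ C ∧ ∀ x, g x < y → x ≤ C := by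
  obtain ⟨b, hb⟩ := eventually_atTop.1 (hg.unbounded.eventually_ge_atTop y)
  refine ⟨max b 0, le_max_right _ _, fun x hx => ?_⟩
  by_contra! h
  exact absurd (hb x ((le_max_left _ _).trans h.le)) (not_le.2 hx)

theorem Policy.adaptive_run_eq (g : ℝ → ℝ) (p : Policy net) (a : ℕ → Counts N) (t : ℕ) :
    ((p.adaptive g).run a t = prevSchedule net ((p.adaptive g).run a) t ∧
      (weight (queue net ((p.adaptive g).run a) a t) (p.rule t a ((p.adaptive g).run a)).1 : ℝ)
        - weight (queue net ((p.adaptive g).run a) a t)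
            (prevSchedule net ((p.adaptive g).run a) t).1
        ≤ g (weight (queue net ((p.adaptive g).run a) a t)
            (p.rule t a ((p.adaptive g).run a)).1)) ∨
    ((p.adaptive g).run a t = p.rule t a ((p.adaptive g).run a) ∧
      g (weight (queue net ((p.adaptive g).run a) a t) (p.rule t a ((p.adaptive g).run a)).1)
        < (weight (queue net ((p.adaptive g).run a) a t)
            (p.rule t a ((p.adaptive g).run a)).1 : ℝ)
          - weight (queue net ((p.adaptive g).run a) a t)
              (prevSchedule net ((p.adaptive g).run a) t).1) := by
  have h := (p.adaptive g).run_eq_rule a t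
  generalize (p.adaptive g).run a = s at h ⊢
  simp only [Policy.adaptive] at h
  split_ifs at h with hif
  · exact Or.inl ⟨h, hif⟩
  · exact Or.inr ⟨h, not_le.1 hif⟩

end Pathwise

/-! ### Pathwise drift of the adaptive policy. -/

section AdaptivePathwise

variable {N : ℕ} {net : Network N}

/-- In an adaptive schedule, the weight deficit grows at most linearly after a switch. -/
theorem maxWeight_le_weight_prevSchedule_add {p : Policy net} {K n Amax : ℕ}
    (hp : p.IsPipelinedMaxWeight K)
    (hn : ∀ S ∈ net.feasible, ∑ i, ∑ j, (S i j).toNat ≤ n) (g : ℝ → ℝ)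
    {a : ℕ → Counts N} (ha : ∀ t i j, a t i j ≤ Amax) {s : ℕ → net.Schedule}
    (hs : s = (p.adaptive g).run a) {k : ℕ} (hk : s k ≠ prevSchedule net s k) (m : ℕ) :
    maxWeight net (queue net s a (k + m + 1))
      ≤ weight (queue net s a (k + m + 1)) (prevSchedule net s (k + m + 1)).1
        + n * (Amax + 1) * K + n * (Amax + 1) * (m + 1) := by
  -- While a schedule is held, its deficit grows by at most `n * (Amax + 1)` per slot; any further
  -- switch resets it to at most the pipeline gap.
  have step : ∀ m', maxWeight net (queue net s a (k + m'))
        ≤ weight (queue net s a (k + m')) (s (k + m')).1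
          + n * (Amax + 1) * K + n * (Amax + 1) * m' →
      maxWeight net (queue net s a (k + m' + 1))
        ≤ weight (queue net s a (k + m' + 1)) (prevSchedule net s (k + m' + 1)).1
          + n * (Amax + 1) * K + n * (Amax + 1) * (m' + 1) := by
    intro m' h
    have h1 := maxWeight_queue_add_le hn s ha (k + m') 1
    have h2 := weight_queue_le_succ (hn _ (s (k + m')).2) s a (k + m')
    simp only [prevSchedule]
    have h3 : n * (Amax + 1) * (m' + 1) = n * (Amax + 1) * m' + n * Amax * 1 + n := by ring
    omega
  refine step m ?_
  induction m with
  | zero =>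
    have h1 := hp.maxWeight_le hn s ha k
    have h2 := p.adaptive_run_eq g a k
    rw [← hs] at h2
    rcases h2 with h2 | h2
    · exact absurd h2.1 hk
    · rw [← h2.1] at h1
      simpa using h1
  | succ m ih =>
    have h1 := hp.maxWeight_le hn s ha (k + m + 1)
    have h2 := p.adaptive_run_eq g a (k + m + 1)
    rw [← hs] at h2
    rcases h2 with h2 | h2
    · rw [← add_assoc, h2.1]
      exact step m ih
    · rw [← h2.1] at h1
      exact h1.trans (Nat.le_add_right _ _)

/-- A kept schedule loses at most `g` of the proposed weight, which is at most a fraction `ε` of it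
plus `C`; a new schedule loses only the pipeline gap. -/
theorem maxWeight_le_weight_adaptive_run {p : Policy net} {K n Amax : ℕ}
    (hp : p.IsPipelinedMaxWeight K)
    (hn : ∀ S ∈ net.feasible, ∑ i, ∑ j, (S i j).toNat ≤ n) {g : ℝ → ℝ}
    {ε C : ℝ} (hε1 : ε ≤ 1) (hC : 0 ≤ C) (hgle : ∀ x, 0 ≤ x → g x ≤ ε * x + C)
    {a : ℕ → Counts N} (ha : ∀ t i j, a t i j ≤ Amax) {s : ℕ → net.Schedule}
    (hs : s = (p.adaptive g).run a) (hε : 0 ≤ ε) (t : ℕ) :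
    (1 - ε) * (maxWeight net (queue net s a t) : ℝ)
      ≤ weight (queue net s a t) (s t).1 + n * (Amax + 1) * K + C := by
  have h1 : (maxWeight net (queue net s a t) : ℝ)
      ≤ weight (queue net s a t) (p.rule t a s).1 + n * (Amax + 1) * K := by
    exact_mod_cast hp.maxWeight_le hn s ha t
  have hB : (0 : ℝ) ≤ n * (Amax + 1) * K := by positivity
  have h2 := p.adaptive_run_eq g a t
  rw [← hs] at h2
  rcases h2 with ⟨h2, h3⟩ | ⟨h2, -⟩
  · rw [← h2] at h3
    have h4 := hgle _ (Nat.cast_nonneg (weight (queue net s a t) (p.rule t a s).1))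
    have h5 := mul_le_mul_of_nonneg_left h1 (sub_nonneg.2 hε1)
    nlinarith
  · rw [← h2] at h1
    have : 0 ≤ ε * (maxWeight net (queue net s a t) : ℝ) := by positivity
    linarith

/-- The service of an adaptive pipelined MaxWeight policy is asymptotically that of an
instantaneous MaxWeight policy, uniformly over the arrivals. -/
theorem exists_sum_maxWeight_le_departures (p : Policy net) {K n Amax : ℕ}
    (hp : p.IsPipelinedMaxWeight K)
    (hn : ∀ S ∈ net.feasible, ∑ i, ∑ j, (S i j).toNat ≤ n) {g : ℝ → ℝ} (hg : IsHysteresis g)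
    {ε : ℝ} (hε : 0 < ε) (hε1 : ε ≤ 1) :
    ∃ C : ℝ, 0 ≤ C ∧ ∀ a : ℕ → Counts N, (∀ t i j, a t i j ≤ Amax) →
      ∀ s : ℕ → net.Schedule, s = (p.adaptive g).run a → ∀ T : ℕ,
      (1 - ε) * ∑ t ∈ Finset.range T, (maxWeight net (queue net s a t) : ℝ)
        ≤ ∑ t ∈ Finset.range T, ((∑ i, ∑ j, queue net s a t i j *
            departures net s t (queue net s a t) i j : ℕ) : ℝ) + C * T := by
  classical
  set D := ⌊net.delay⌋₊ with hD
  -- The loss `ε` is split evenly: one half for reconfiguration, at rate `(D + 1) / M`, the other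
  -- for hysteresis.
  obtain ⟨M, hM⟩ := exists_nat_gt ((D + 1 : ℝ) / (ε / 2))
  have hMpos : (0 : ℝ) < M := lt_of_le_of_lt (by positivity) hM
  have hMpos' : 0 < M := by exact_mod_cast hMpos
  have hDM : (D + 1 : ℝ) * (1 / M) ≤ ε / 2 := by
    rw [div_lt_iff₀ (by positivity)] at hM
    rw [mul_one_div, div_le_iff₀ hMpos]
    linarith
  obtain ⟨Cg, hCg, hgle⟩ := hg.exists_le_add (half_pos hε)
  set B : ℝ := n * (Amax + 1) * K with hB
  have hB0 : 0 ≤ B := by positivity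
  set c : ℝ := n * Amax with hc
  have hc0 : 0 ≤ c := by positivity
  obtain ⟨Cs, hCs, hgs⟩ := hg.exists_le_of_le (B + n * (Amax + 1) * M)
  -- The first bracket bounds W* at a switch that follows another within `M` slots, the second
  -- bounds it at any time before `M`.
  set C1 : ℝ := (Cs + B) + (maxWeight net net.initQueue + c * M) with hC1
  have hC10 : 0 ≤ C1 := by positivity
  refine ⟨B + Cg + (D + 1) * (C1 + c + c * D), by positivity, fun a ha s hs T => ?_⟩
  set W : ℕ → ℝ := fun t => (maxWeight net (queue net s a t) : ℝ) with hWdef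
  have hW : ∀ t, 0 ≤ W t := fun t => Nat.cast_nonneg _
  have hlip : ∀ t m : ℕ, W (t + m) ≤ W t + c * m := fun t m => by
    simp only [hWdef, hc]
    exact_mod_cast maxWeight_queue_add_le hn s ha t m
  have hsw : ∀ k, s k ≠ prevSchedule net s k → W k ≤ C1 ∨
      (M ≤ k ∧ ∀ k', k - M ≤ k' → k' < k → ¬ s k' ≠ prevSchedule net s k') := by
    intro k hk
    by_cases hMk : M ≤ k
    · by_cases hno : ∀ k', k - M ≤ k' → k' < k → ¬ s k' ≠ prevSchedule net s k'
      · exact Or.inr ⟨hMk, hno⟩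
      · left
        push Not at hno
        obtain ⟨k', h1, h2, h3⟩ := hno
        obtain ⟨m, rfl⟩ : ∃ m, k = k' + m + 1 := ⟨k - k' - 1, by omega⟩
        have h4 : W (k' + m + 1)
            ≤ weight (queue net s a (k' + m + 1)) (prevSchedule net s (k' + m + 1)).1
              + B + n * (Amax + 1) * ((m + 1 : ℕ) : ℝ) := by
          simp only [hWdef, hB]
          exact_mod_cast maxWeight_le_weight_prevSchedule_add hp hn g ha hs h3 m
        have h5 : (n * (Amax + 1) : ℝ) * ((m + 1 : ℕ) : ℝ) ≤ n * (Amax + 1) * M :=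
          mul_le_mul_of_nonneg_left (by exact_mod_cast (by omega)) (by positivity)
        have h6 := p.adaptive_run_eq g a (k' + m + 1)
        rw [← hs] at h6
        rcases h6 with h6 | ⟨-, h6⟩
        · exact absurd h6.1 hk
        · have h7 : (weight (queue net s a (k' + m + 1)) (p.rule (k' + m + 1) a s).1 : ℝ)
              ≤ W (k' + m + 1) := by
            simp only [hWdef]
            exact_mod_cast weight_le_maxWeight _ _
          have h8 := hgs _ (h6.trans_le (by linarith))
          have h9 : W (k' + m + 1)
              ≤ weight (queue net s a (k' + m + 1)) (p.rule (k' + m + 1) a s).1 + B := by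
            simp only [hWdef, hB]
            exact_mod_cast hp.maxWeight_le hn s ha (k' + m + 1)
          have : 0 ≤ (maxWeight net net.initQueue : ℝ) + c * M := by positivity
          linarith
    · left
      have h1 := hlip 0 k
      rw [zero_add] at h1
      have h2 : W 0 = maxWeight net net.initQueue := rfl
      have h3 : c * (k : ℝ) ≤ c * M :=
        mul_le_mul_of_nonneg_left (by exact_mod_cast (not_le.1 hMk).le) hc0
      linarith
  have hR : ∀ t, Reconfiguring net s t →
      ∃ k ≤ t, s k ≠ prevSchedule net s k ∧ t ≤ k + D := by
    rintro t ⟨k, hkt, hk, ht⟩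
    refine ⟨k, hkt, hk, ?_⟩
    have : t - k ≤ D := Nat.le_floor (by rw [Nat.cast_sub hkt]; linarith)
    omega
  have hnear := sum_near_marked_le W hW (fun k => s k ≠ prevSchedule net s k)
    (Reconfiguring net s) hc0 hlip D hR T
  have hmark := sum_marked_le W hW (fun k => s k ≠ prevSchedule net s k) hMpos' hc0 hC10
    hlip hsw T
  -- Reconfiguring slots are written off completely: there the left side is nonpositive.
  have hslot : ∀ t, (1 - ε / 2) * W t - (if Reconfiguring net s t then W t else 0)
      ≤ ((∑ i, ∑ j, queue net s a t i j *
          departures net s t (queue net s a t) i j : ℕ) : ℝ) + (B + Cg) := by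
    intro t
    split_ifs with h
    · have h1 : 0 ≤ ε / 2 * W t := mul_nonneg (by positivity) (hW t)
      have h2 : (0 : ℝ) ≤ ((∑ i, ∑ j, queue net s a t i j *
          departures net s t (queue net s a t) i j : ℕ) : ℝ) := Nat.cast_nonneg _
      linarith
    · rw [weight_departures s t _ h]
      have := maxWeight_le_weight_adaptive_run hp hn (by linarith) hCg hgle ha hs
        (by positivity) t
      simp only [hWdef]
      linarith
  have hsum := Finset.sum_le_sum fun t (_ : t ∈ Finset.range T) => hslot t
  rw [Finset.sum_sub_distrib, ← Finset.mul_sum, Finset.sum_add_distrib, Finset.sum_const,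
    Finset.card_range, nsmul_eq_mul] at hsum
  have hSW : 0 ≤ ∑ t ∈ Finset.range T, W t := Finset.sum_nonneg fun t _ => hW t
  have h1 := mul_le_mul_of_nonneg_left hmark (show (0 : ℝ) ≤ D + 1 by positivity)
  have h2 := mul_le_mul_of_nonneg_right hDM hSW
  linarith

/-- Expand the square of L + (A - D) and telescope; |A - D| ≤ `Amax + 1` in each entry. -/
theorem sum_sq_queue_le (s : ℕ → net.Schedule) {a : ℕ → Counts N} {Amax : ℕ}
    (ha : ∀ t i j, a t i j ≤ Amax) (T : ℕ) :
    ∑ i, ∑ j, (queue net s a T i j : ℝ) ^ 2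
      ≤ ∑ i, ∑ j, (net.initQueue i j : ℝ) ^ 2
        + 2 * ∑ t ∈ Finset.range T, ∑ i, ∑ j, (queue net s a t i j : ℝ) * a t i j
        - 2 * ∑ t ∈ Finset.range T, ((∑ i, ∑ j, queue net s a t i j *
            departures net s t (queue net s a t) i j : ℕ) : ℝ)
        + N * N * (Amax + 1) ^ 2 * T := by
  induction T with
  | zero => simp [queue]
  | succ T ih =>
    have hstep : ∀ i j, (queue net s a (T + 1) i j : ℝ) ^ 2
        ≤ (queue net s a T i j : ℝ) ^ 2 + 2 * ((queue net s a T i j : ℝ) * a T i j)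
          - 2 * ((queue net s a T i j : ℝ) * departures net s T (queue net s a T) i j)
          + (Amax + 1) ^ 2 := by
      intro i j
      have h1 : (queue net s a (T + 1) i j : ℝ) + departures net s T (queue net s a T) i j
          = queue net s a T i j + a T i j := by
        exact_mod_cast queue_succ_add_departures s a T i j
      have h2 : (departures net s T (queue net s a T) i j : ℝ) ≤ 1 := by
        exact_mod_cast (departures_le_toNat s T _ i j).trans (Bool.toNat_le _)
      have h3 : (a T i j : ℝ) ≤ Amax := by exact_mod_cast ha T i j
      have h4 : (0 : ℝ) ≤ departures net s T (queue net s a T) i j := Nat.cast_nonneg _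
      have h5 : (0 : ℝ) ≤ a T i j := Nat.cast_nonneg _
      rw [eq_sub_of_add_eq h1]
      generalize (departures net s T (queue net s a T) i j : ℝ) = d at *
      generalize (a T i j : ℝ) = x at *
      have h6 : (x - d) ^ 2 ≤ (Amax + 1) ^ 2 := by
        apply sq_le_sq'
        · linarith
        · linarith
      nlinarith
    have hsum := Finset.sum_le_sum fun i (_ : i ∈ Finset.univ) =>
      Finset.sum_le_sum fun j (_ : j ∈ (Finset.univ : Finset (Fin N))) => hstep i j
    simp only [Finset.sum_add_distrib, Finset.sum_sub_distrib, ← Finset.mul_sum,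
      Finset.sum_const, Finset.card_univ, Fintype.card_fin, nsmul_eq_mul] at hsum
    rw [Finset.sum_range_succ, Finset.sum_range_succ]
    push_cast at ih ⊢
    linarith

/-- The drift inequality of an adaptive pipelined MaxWeight policy along a path. -/
theorem exists_sum_maxWeight_le_arrivals (p : Policy net) {K : ℕ} (Amax : ℕ)
    (hp : p.IsPipelinedMaxWeight K) {g : ℝ → ℝ} (hg : IsHysteresis g)
    {ε : ℝ} (hε : 0 < ε) (hε1 : ε ≤ 1) :
    ∃ C : ℝ, 0 ≤ C ∧ ∀ a : ℕ → Counts N, (∀ t i j, a t i j ≤ Amax) → ∀ T : ℕ,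
      (1 - ε) * ∑ t ∈ Finset.range T,
          (maxWeight net (queue net ((p.adaptive g).run a) a t) : ℝ)
        ≤ ∑ t ∈ Finset.range T, ∑ i, ∑ j,
            (queue net ((p.adaptive g).run a) a t i j : ℝ) * a t i j + C * (T + 1) := by
  obtain ⟨C, hC, h⟩ := exists_sum_maxWeight_le_departures (Amax := Amax) p hp
    (fun S _ => sum_toNat_le_mul S) hg hε hε1
  set V : ℝ := ∑ i, ∑ j, (net.initQueue i j : ℝ) ^ 2 with hV
  have hV0 : 0 ≤ V := by positivity
  refine ⟨C + N * N * (Amax + 1) ^ 2 + V, by positivity, fun a ha T => ?_⟩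
  have h1 := h a ha _ rfl T
  have h2 := sum_sq_queue_le ((p.adaptive g).run a) ha T
  have h3 : 0 ≤ ∑ i, ∑ j, (queue net ((p.adaptive g).run a) a T i j : ℝ) ^ 2 := by positivity
  have h4 : (0 : ℝ) ≤ N * N * (Amax + 1) ^ 2 * T := by positivity
  have h5 : (0 : ℝ) ≤ N * N * (Amax + 1) ^ 2 := by positivity
  have h6 : 0 ≤ V * T := by positivity
  nlinarith

end AdaptivePathwise

/-! ### Necessary conditions for admissibility, and the load. -/

section Stability

variable {N : ℕ} {net : Network N} {Ω : Type u} [MeasurableSpace Ω] {P : Measure Ω}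
  {A : ℕ → Ω → Counts N}

theorem IsTraffic.integrable_arrivals (hA : IsTraffic P A) (t : ℕ) (i j : Fin N) :
    Integrable (fun ω => (A t ω i j : ℝ)) P :=
  ((hA.identDistrib t i j).comp (u := fun k : ℕ => (k : ℝ))
    Measurable.of_discrete).integrable_iff.2 (hA.integrable i j)

theorem IsTraffic.integral_arrivals (hA : IsTraffic P A) (t : ℕ) (i j : Fin N) :
    ∫ ω, (A t ω i j : ℝ) ∂P = rate P A i j :=
  ((hA.identDistrib t i j).comp (u := fun k : ℕ => (k : ℝ))
    Measurable.of_discrete).integral_eq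

theorem rate_nonneg (i j : Fin N) : 0 ≤ rate P A i j :=
  integral_nonneg fun _ => Nat.cast_nonneg _

/-- Conservation of weighted packets: one slot removes at most the `w`-weight of its schedule. -/
theorem sum_weighted_arrivals_le (s : ℕ → net.Schedule) (a : ℕ → Counts N) (w : Counts N)
    (T : ℕ) :
    ∑ t ∈ Finset.range T, ∑ i, ∑ j, w i j * a t i j
      ≤ ∑ i, ∑ j, w i j * queue net s a T i j + T * maxWeight net w := by
  induction T with
  | zero => simp
  | succ T ih =>
    have hstep : ∑ i, ∑ j, w i j * queue net s a T i j + ∑ i, ∑ j, w i j * a T i j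
        ≤ ∑ i, ∑ j, w i j * queue net s a (T + 1) i j + weight w (s T).1 := by
      simp only [weight, ← Finset.sum_add_distrib, ← mul_add]
      exact Finset.sum_le_sum fun i _ => Finset.sum_le_sum fun j _ =>
        Nat.mul_le_mul_left _ (queue_add_arrivals_le s a T i j)
    have := weight_le_maxWeight w (s T)
    rw [Finset.sum_range_succ, add_mul]
    omega

theorem sum_weighted_queue_le (p : Policy net) (a : ℕ → Counts N) (w : Counts N) (T : ℕ) :
    ∑ i, ∑ j, w i j * queue net (p.run a) a T i j ≤ (∑ i, ∑ j, w i j) * totalQueue p a T := by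
  simp only [Finset.sum_mul]
  refine Finset.sum_le_sum fun i _ => Finset.sum_le_sum fun j _ => Nat.mul_le_mul_left _ ?_
  unfold totalQueue
  refine le_trans ?_ (Finset.single_le_sum (f := fun i => ∑ j, queue net (p.run a) a T i j)
    (fun _ _ => Nat.zero_le _) (Finset.mem_univ i))
  exact Finset.single_le_sum (f := fun j => queue net (p.run a) a T i j)
    (fun _ _ => Nat.zero_le _) (Finset.mem_univ j)

/-- Every weighting of the rates of admissible traffic is at most the weight of a schedule. -/
theorem Admissible.sum_mul_rate_le [IsProbabilityMeasure P] (hA : IsTraffic P A)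
    (h : Admissible net P A) (w : Counts N) :
    ∑ i, ∑ j, (w i j : ℝ) * rate P A i j ≤ maxWeight net w := by
  obtain ⟨p, hp⟩ := h
  set l : ℝ := ∑ i, ∑ j, (w i j : ℝ) * rate P A i j with hl
  set m : ℕ := maxWeight net w
  set b : ℕ := ∑ i, ∑ j, w i j with hb
  have hl0 : 0 ≤ l := Finset.sum_nonneg fun i _ => Finset.sum_nonneg fun j _ =>
    mul_nonneg (Nat.cast_nonneg _) (rate_nonneg i j)
  set X : ℕ → ℝ≥0∞ := fun τ => ∫⁻ ω, (totalQueue p (fun t' => A t' ω) τ : ℝ≥0∞) ∂P with hX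
  -- If `l > m`, this forces the expected queue to grow linearly. Only its time averages are
  -- controlled, so the bound is summed over `T < t`: a quadratic lower bound then meets a linear
  -- upper bound. The values `X T` might be infinite, hence `ℝ≥0∞`.
  have hslot : ∀ T : ℕ, ENNReal.ofReal (T * l) ≤ b * X T + T * m := by
    intro T
    have hint : ∀ t i j, Integrable (fun ω => (w i j : ℝ) * (A t ω i j : ℝ)) P :=
      fun t i j => (hA.integrable_arrivals t i j).const_mul _
    have hint1 : ∀ t i, Integrable (fun ω => ∑ j, (w i j : ℝ) * (A t ω i j : ℝ)) P :=
      fun t i => integrable_finsetSum _ fun j _ => hint t i j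
    have hint2 : ∀ t, Integrable (fun ω => ∑ i, ∑ j, (w i j : ℝ) * (A t ω i j : ℝ)) P :=
      fun t => integrable_finsetSum _ fun i _ => hint1 t i
    have hint3 : Integrable (fun ω => ∑ t ∈ Finset.range T, ∑ i, ∑ j,
        (w i j : ℝ) * (A t ω i j : ℝ)) P := integrable_finsetSum _ fun t _ => hint2 t
    have heq : ∫ ω, ∑ t ∈ Finset.range T, ∑ i, ∑ j, (w i j : ℝ) * (A t ω i j : ℝ) ∂P
        = T * l := by
      rw [integral_finsetSum _ fun t _ => hint2 t]
      have : ∀ t, ∫ ω, ∑ i, ∑ j, (w i j : ℝ) * (A t ω i j : ℝ) ∂P = l := fun t => by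
        rw [integral_finsetSum _ fun i _ => hint1 t i]
        refine Finset.sum_congr rfl fun i _ => ?_
        rw [integral_finsetSum _ fun j _ => hint t i j]
        refine Finset.sum_congr rfl fun j _ => ?_
        rw [integral_const_mul, hA.integral_arrivals]
      simp [this]
    rw [← heq, ofReal_integral_eq_lintegral_ofReal hint3 (Eventually.of_forall fun ω => by
      positivity)]
    calc ∫⁻ ω, ENNReal.ofReal (∑ t ∈ Finset.range T, ∑ i, ∑ j,
            (w i j : ℝ) * (A t ω i j : ℝ)) ∂P
        ≤ ∫⁻ ω, ((b : ℝ≥0∞) * (totalQueue p (fun t' => A t' ω) T : ℝ≥0∞)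
            + (T : ℝ≥0∞) * (m : ℝ≥0∞)) ∂P := by
          refine lintegral_mono fun ω => ?_
          have h1 := (sum_weighted_arrivals_le (p.run fun t' => A t' ω) (fun t' => A t' ω) w
            T).trans (Nat.add_le_add_right (sum_weighted_queue_le p (fun t' => A t' ω) w T) _)
          have h2 : ENNReal.ofReal (∑ t ∈ Finset.range T, ∑ i, ∑ j,
              (w i j : ℝ) * (A t ω i j : ℝ))
              = ((∑ t ∈ Finset.range T, ∑ i, ∑ j, w i j * A t ω i j : ℕ) : ℝ≥0∞) := by
            rw [← ENNReal.ofReal_natCast]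
            push_cast
            rfl
          rw [h2]
          refine (Nat.cast_le.2 h1).trans (le_of_eq ?_)
          rw [Nat.cast_add, Nat.cast_mul, Nat.cast_mul]
      _ = b * X T + T * m := by
          rw [lintegral_add_right _ measurable_const,
            lintegral_const_mul' _ _ (ENNReal.natCast_ne_top b)]
          simp [hX]
  obtain ⟨C, hC, -⟩ := ENNReal.lt_iff_exists_nnreal_btwn.1 hp
  have hev := eventually_lt_of_limsup_lt hC
  by_contra! hlt
  -- The threshold makes `(l - m) * t * (t - 1) / 2` exceed `b * C * t`.
  obtain ⟨t, hev, htpos, htbig⟩ := (hev.and ((eventually_ge_atTop 1).and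
    (eventually_gt_atTop (⌈(2 * (b * C) / (l - m) : ℝ)⌉₊ + 1)))).exists
  have hsumX : ∑ τ ∈ Finset.range t, X τ ≤ C * t := by
    rw [ENNReal.div_lt_iff (Or.inl (by positivity)) (Or.inl (ENNReal.natCast_ne_top t))] at hev
    exact hev.le
  have hsum : ENNReal.ofReal (∑ T ∈ Finset.range t, T * l)
      ≤ ENNReal.ofReal (b * (C * t) + ∑ T ∈ Finset.range t, (T : ℝ) * m) := by
    rw [ENNReal.ofReal_sum_of_nonneg fun T _ => mul_nonneg (Nat.cast_nonneg _) hl0,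
      ENNReal.ofReal_add (by positivity) (by positivity),
      ENNReal.ofReal_sum_of_nonneg fun T _ => by positivity]
    calc ∑ T ∈ Finset.range t, ENNReal.ofReal (T * l)
        ≤ ∑ T ∈ Finset.range t, (b * X T + T * m) := Finset.sum_le_sum fun T _ => hslot T
      _ = b * ∑ T ∈ Finset.range t, X T + ∑ T ∈ Finset.range t, (T : ℝ≥0∞) * m := by
          rw [Finset.sum_add_distrib, Finset.mul_sum]
      _ ≤ b * (C * t) + ∑ T ∈ Finset.range t, (T : ℝ≥0∞) * m := by gcongr
      _ = _ := by
          congr 1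
          · rw [ENNReal.ofReal_mul (by positivity), ENNReal.ofReal_mul (by positivity)]
            simp
          · refine Finset.sum_congr rfl fun T _ => ?_
            rw [ENNReal.ofReal_mul (by positivity)]
            simp
  rw [ENNReal.ofReal_le_ofReal_iff (by positivity), ← Finset.sum_mul, ← Finset.sum_mul] at hsum
  have hgauss : (∑ T ∈ Finset.range t, (T : ℝ)) * 2 = t * (t - 1) := by
    have h1 := Finset.sum_range_id_mul_two t
    have h2 : ((t - 1 : ℕ) : ℝ) = t - 1 := by rw [Nat.cast_sub htpos, Nat.cast_one]
    rw [← h2, ← Nat.cast_mul, ← h1]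
    push_cast
    rfl
  have ht0 : (0 : ℝ) < t := by exact_mod_cast htpos
  have hbig : 2 * (b * C) / (l - m) < t - 1 := by
    have h1 := Nat.le_ceil (2 * (b * C) / (l - m) : ℝ)
    have h2 : ((⌈(2 * (b * C) / (l - m) : ℝ)⌉₊ + 1 : ℕ) : ℝ) < t := by exact_mod_cast htbig
    push_cast at h2
    linarith
  rw [div_lt_iff₀ (sub_pos.2 hlt)] at hbig
  have := mul_lt_mul_of_pos_right hbig ht0
  nlinarith

/-- Each `w` defines a closed half-space containing the capacity region, hence its closure; scaling
by `r` yields the slack. -/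
theorem exists_sum_mul_le_of_load_lt_one {l : Fin N → Fin N → ℝ} (h : load net l < 1) :
    ∃ r : ℝ, 0 < r ∧ r < 1 ∧
      ∀ w : Counts N, ∑ i, ∑ j, (w i j : ℝ) * l i j ≤ r * maxWeight net w := by
  unfold load at h
  simp only [iInf_lt_iff] at h
  obtain ⟨r, ⟨hr0, hr1, hl⟩, -⟩ := h
  refine ⟨r, by exact_mod_cast hr0, by exact_mod_cast hr1, fun w => ?_⟩
  obtain ⟨x, hx, rfl⟩ := Set.mem_smul_set.1 hl
  have hclosed : IsClosed {x : Fin N → Fin N → ℝ |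
      ∑ i, ∑ j, (w i j : ℝ) * x i j ≤ maxWeight net w} :=
    isClosed_le (by fun_prop) continuous_const
  have hsub : capacityRegion net ⊆ {x : Fin N → Fin N → ℝ |
      ∑ i, ∑ j, (w i j : ℝ) * x i j ≤ maxWeight net w} := by
    rintro _ ⟨Ω', _, P', A', hP', hA', hadm, rfl⟩
    exact hadm.sum_mul_rate_le hA' w
  have hx' := closure_minimal hsub hclosed hx
  calc ∑ i, ∑ j, (w i j : ℝ) * ((r : ℝ) • x) i j
      = r * ∑ i, ∑ j, (w i j : ℝ) * x i j := by
        simp only [Finset.mul_sum, Pi.smul_apply, smul_eq_mul]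
        exact Finset.sum_congr rfl fun i _ => Finset.sum_congr rfl fun j _ => by ring
    _ ≤ _ := mul_le_mul_of_nonneg_left hx' r.2

/-! ### Measurability and independence of the history. -/

/-- The arrivals in the slots before `t`, as a finite family. -/
abbrev historyIndex (N t : ℕ) : Finset (ℕ × Fin N × Fin N) :=
  Finset.range t ×ˢ Finset.univ

/-- Arrivals with a given history that vanish afterwards. -/
def extendHistory (t : ℕ) (h : historyIndex N t → ℕ) : ℕ → Counts N := fun τ i j =>
  if hτ : (τ, i, j) ∈ historyIndex N t then h ⟨(τ, i, j), hτ⟩ else 0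

/-- Factoring through finitely many integer-valued variables makes the outer map automatically
measurable, its domain being discrete. -/
theorem eq_comp_extendHistory {Ω : Type*} {A : ℕ → Ω → Counts N} {β : Type*} {t : ℕ} {f : (ℕ → Counts N) → β}
    (hf : ∀ a a', (∀ τ < t, a τ = a' τ) → f a = f a') :
    (fun ω => f fun t' => A t' ω) = (f ∘ extendHistory t) ∘
      fun ω (q : historyIndex N t) => A q.1.1 ω q.1.2.1 q.1.2.2 := by
  funext ω
  refine hf _ _ fun τ hτ => ?_
  funext i j
  simp [extendHistory, hτ]

theorem IsTraffic.measurable_history (hA : IsTraffic P A) {β : Type*} [MeasurableSpace β]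
    {t : ℕ} {f : (ℕ → Counts N) → β}
    (hf : ∀ a a', (∀ τ < t, a τ = a' τ) → f a = f a') :
    Measurable fun ω => f fun t' => A t' ω := by
  rw [eq_comp_extendHistory hf]
  exact (Measurable.of_discrete (f := f ∘ extendHistory t)).comp
    (measurable_pi_lambda _ fun q => hA.measurable _ _ _)

theorem IsTraffic.indepFun_history (hA : IsTraffic P A) {β : Type*} [MeasurableSpace β]
    {t : ℕ} {f : (ℕ → Counts N) → β}
    (hf : ∀ a a', (∀ τ < t, a τ = a' τ) → f a = f a') (i j : Fin N) :
    IndepFun (fun ω => f fun t' => A t' ω) (fun ω => (A t ω i j : ℝ)) P := by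
  rw [eq_comp_extendHistory hf]
  have hdisj : Disjoint (historyIndex N t) {(t, i, j)} := by
    simp [historyIndex]
  have := hA.indep.indepFun_finset _ _ hdisj fun q => hA.measurable _ _ _
  exact this.comp (φ := f ∘ extendHistory t)
    (ψ := fun h => (h ⟨(t, i, j), Finset.mem_singleton_self _⟩ : ℝ))
    Measurable.of_discrete
    (Measurable.of_discrete.comp (measurable_pi_apply _))

theorem queue_le_initQueue_add (s : ℕ → net.Schedule) (a : ℕ → Counts N) (t : ℕ) (i j : Fin N) :
    queue net s a t i j ≤ net.initQueue i j + ∑ τ ∈ Finset.range t, a τ i j := by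
  induction t with
  | zero => simp [queue]
  | succ t ih =>
    have := queue_succ_add_departures s a t i j
    rw [Finset.sum_range_succ]
    omega

theorem le_maxWeight {S : Fin N → Fin N → Bool} (hS : S ∈ net.feasible) {i j : Fin N}
    (hij : S i j = true) (L : Counts N) : L i j ≤ maxWeight net L := by
  refine le_trans ?_ (weight_le_maxWeight L ⟨S, hS⟩)
  unfold weight
  refine le_trans ?_ (Finset.single_le_sum (f := fun i => ∑ j, L i j * (S i j).toNat)
    (fun _ _ => Nat.zero_le _) (Finset.mem_univ i))
  refine le_trans ?_ (Finset.single_le_sum (f := fun j => L i j * (S i j).toNat)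
    (fun _ _ => Nat.zero_le _) (Finset.mem_univ j))
  simp [hij]

/-- Queues that no schedule serves receive no traffic within the capacity region, so that the
queues are almost surely controlled by the maximum weight. -/
theorem ae_queue_le_maxWeight_add (hA : IsTraffic P A) (p : Policy net) {r : ℝ}
    (hr : ∀ w : Counts N, ∑ i, ∑ j, (w i j : ℝ) * rate P A i j ≤ r * maxWeight net w)
    (t : ℕ) (i j : Fin N) :
    ∀ᵐ ω ∂P, queue net (p.run fun t' => A t' ω) (fun t' => A t' ω) t i j
      ≤ maxWeight net (queue net (p.run fun t' => A t' ω) (fun t' => A t' ω) t)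
        + net.initQueue i j := by
  by_cases hcov : ∃ S ∈ net.feasible, S i j = true
  · obtain ⟨S, hS, hij⟩ := hcov
    exact Eventually.of_forall fun ω =>
      (le_maxWeight hS hij _).trans (Nat.le_add_right _ _)
  · push Not at hcov
    -- Testing the rate bound on the indicator of an unserved queue shows that its rate is 0.
    set w : Counts N := fun i' j' => if i' = i ∧ j' = j then 1 else 0 with hw
    have hmax : maxWeight net w = 0 := by
      refine Nat.eq_zero_of_le_zero (Finset.sup_le fun S hS => ?_)
      refine le_of_eq (Finset.sum_eq_zero fun i' _ => Finset.sum_eq_zero fun j' _ => ?_)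
      simp only [hw]
      split_ifs with h
      · rw [h.1, h.2]
        simpa using hcov S hS
      · simp
    have hsum : ∑ i', ∑ j', (w i' j' : ℝ) * rate P A i' j' = rate P A i j := by
      rw [Finset.sum_eq_single i, Finset.sum_eq_single j]
      · simp [hw]
      · intro j' _ h
        simp [hw, h]
      · simp
      · intro i' _ h
        simp [hw, h]
      · simp
    have hrate : rate P A i j = 0 := by
      have := hr w
      rw [hsum, hmax, Nat.cast_zero, mul_zero] at this
      exact le_antisymm this (rate_nonneg i j)
    have hzero : ∀ᵐ ω ∂P, ∀ τ, A τ ω i j = 0 := by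
      rw [ae_all_iff]
      intro τ
      have h1 := hA.integral_arrivals τ i j
      rw [hrate, integral_eq_zero_iff_of_nonneg (fun ω => Nat.cast_nonneg _)
        (hA.integrable_arrivals τ i j)] at h1
      filter_upwards [h1] with ω hω
      simpa using hω
    filter_upwards [hzero] with ω hω
    have := queue_le_initQueue_add (p.run fun t' => A t' ω) (fun t' => A t' ω) t i j
    simp only [hω, Finset.sum_const_zero, add_zero] at this
    exact this.trans (Nat.le_add_left _ _)

/-! ### From the drift inequality to strong stability. -/

theorem stronglyStable_of_sum_le {p : Policy net} {C : ℝ} (hC : 0 ≤ C) (y : ℕ → ℝ)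
    (hy0 : ∀ t, 0 ≤ y t)
    (h : ∀ t, ∫⁻ ω, (totalQueue p (fun t' => A t' ω) t : ℝ≥0∞) ∂P ≤ ENNReal.ofReal (y t))
    (hy : ∀ T : ℕ, ∑ t ∈ Finset.range T, y t ≤ C * (T + 1)) : StronglyStable p P A := by
  refine lt_of_le_of_lt (limsup_le_of_le (by isBoundedDefault)
    (a := ENNReal.ofReal (2 * C)) ?_) ENNReal.ofReal_lt_top
  filter_upwards [eventually_ge_atTop 1] with T hT
  have hT' : (1 : ℝ) ≤ T := by exact_mod_cast hT
  refine ENNReal.div_le_of_le_mul ?_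
  calc ∑ τ ∈ Finset.range T, ∫⁻ ω, (totalQueue p (fun t' => A t' ω) τ : ℝ≥0∞) ∂P
      ≤ ∑ τ ∈ Finset.range T, ENNReal.ofReal (y τ) := Finset.sum_le_sum fun τ _ => h τ
    _ = ENNReal.ofReal (∑ τ ∈ Finset.range T, y τ) :=
        (ENNReal.ofReal_sum_of_nonneg fun τ _ => hy0 τ).symm
    _ ≤ ENNReal.ofReal (2 * C * T) := ENNReal.ofReal_le_ofReal ((hy T).trans (by nlinarith))
    _ = ENNReal.ofReal (2 * C) * T := by
        rw [ENNReal.ofReal_mul (by positivity), ENNReal.ofReal_natCast]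

theorem Policy.IsPipelinedMaxWeight.stronglyStable_adaptive [IsProbabilityMeasure P]
    {p : Policy net} {K : ℕ} (hp : p.IsPipelinedMaxWeight K) {g : ℝ → ℝ} (hg : IsHysteresis g)
    (hA : IsTraffic P A) {Amax : ℕ} (hb : ∀ t ω i j, A t ω i j ≤ Amax) {r : ℝ} (hr1 : r < 1)
    (hr0 : 0 < r)
    (hr : ∀ w : Counts N, ∑ i, ∑ j, (w i j : ℝ) * rate P A i j ≤ r * maxWeight net w) :
    StronglyStable (p.adaptive g) P A := by
  obtain ⟨C, hC, hdrift⟩ := exists_sum_maxWeight_le_arrivals p Amax hp hg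
    -- With this choice `1 - ε - r = (1 - r) / 2` remains as the coefficient of Σ E W*.
    (ε := (1 - r) / 2) (by linarith) (by linarith)
  set Q : ℕ → Ω → Counts N := fun t ω =>
    queue net ((p.adaptive g).run fun t' => A t' ω) (fun t' => A t' ω) t with hQ
  -- A crude bound at fixed `t`, used only for integrability.
  have hQbound : ∀ t ω i j, Q t ω i j ≤ net.initQueue i j + t * Amax := fun t ω i j => by
    refine (queue_le_initQueue_add _ _ t i j).trans (Nat.add_le_add_left ?_ _)
    exact (Finset.sum_le_sum fun τ _ => hb τ ω i j).trans (by simp)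
  have hQint : ∀ t i j, Integrable (fun ω => (Q t ω i j : ℝ)) P := fun t i j => by
    refine Integrable.of_bound (C := (net.initQueue i j + t * Amax : ℕ)) ?_
      (Eventually.of_forall fun ω => ?_)
    · exact (hA.measurable_history (f := fun a =>
        (queue net ((p.adaptive g).run a) a t i j : ℝ)) fun a a' h => by
          rw [queue_run_congr _ h]).aestronglyMeasurable
    · rw [Real.norm_natCast]
      exact_mod_cast hQbound t ω i j
  have hWint : ∀ t, Integrable (fun ω => (maxWeight net (Q t ω) : ℝ)) P := fun t => by
    refine Integrable.of_bound
      (C := (maxWeight net net.initQueue + N * N * Amax * t : ℕ)) ?_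
      (Eventually.of_forall fun ω => ?_)
    · exact (hA.measurable_history (f := fun a =>
        (maxWeight net (queue net ((p.adaptive g).run a) a t) : ℝ)) fun a a' h => by
          rw [queue_run_congr _ h]).aestronglyMeasurable
    · rw [Real.norm_natCast]
      have := maxWeight_queue_add_le (net := net) (fun S _ => sum_toNat_le_mul S)
        ((p.adaptive g).run fun t' => A t' ω) (fun t' i j => hb t' ω i j) 0 t
      rw [zero_add] at this
      exact_mod_cast this
  -- Although S(t) may depend on A(t), the queue L(t) is determined by the arrivals before `t`.
  have hindep : ∀ t i j, IndepFun (fun ω => (Q t ω i j : ℝ)) (fun ω => (A t ω i j : ℝ)) P :=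
    fun t i j => hA.indepFun_history (f := fun a =>
        (queue net ((p.adaptive g).run a) a t i j : ℝ)) (fun a a' h => by
          rw [queue_run_congr _ h]) i j
  have hQAint : ∀ t i j, Integrable (fun ω => (Q t ω i j : ℝ) * (A t ω i j : ℝ)) P :=
    fun t i j => (hindep t i j).integrable_mul (hQint t i j) (hA.integrable_arrivals t i j)
  have hQA : ∀ t, ∫ ω, ∑ i, ∑ j, (Q t ω i j : ℝ) * (A t ω i j : ℝ) ∂P
      ≤ r * ∫ ω, (maxWeight net (Q t ω) : ℝ) ∂P := by
    intro t
    have h1 : ∫ ω, ∑ i, ∑ j, (Q t ω i j : ℝ) * (A t ω i j : ℝ) ∂P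
        = ∫ ω, ∑ i, ∑ j, (Q t ω i j : ℝ) * rate P A i j ∂P := by
      rw [integral_finsetSum _ fun i _ => integrable_finsetSum _ fun j _ => hQAint t i j,
        integral_finsetSum _ fun i _ => integrable_finsetSum _ fun j _ =>
          (hQint t i j).mul_const _]
      refine Finset.sum_congr rfl fun i _ => ?_
      rw [integral_finsetSum _ fun j _ => hQAint t i j,
        integral_finsetSum _ fun j _ => (hQint t i j).mul_const _]
      refine Finset.sum_congr rfl fun j _ => ?_
      rw [integral_mul_const, ← hA.integral_arrivals t i j]
      exact (hindep t i j).integral_fun_mul_eq_mul_integral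
        (hQint t i j).aestronglyMeasurable (hA.integrable_arrivals t i j).aestronglyMeasurable
    rw [h1, ← integral_const_mul]
    exact integral_mono (integrable_finsetSum _ fun i _ => integrable_finsetSum _ fun j _ =>
      (hQint t i j).mul_const _) ((hWint t).const_mul _) fun ω => hr (Q t ω)
  set x : ℕ → ℝ := fun t => ∫ ω, (maxWeight net (Q t ω) : ℝ) ∂P with hx
  have hx0 : ∀ t, 0 ≤ x t := fun t => integral_nonneg fun ω => Nat.cast_nonneg _
  have hsum : ∀ T : ℕ, (1 - r) / 2 * ∑ t ∈ Finset.range T, x t ≤ C * (T + 1) := by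
    intro T
    have hQAint2 : ∀ t, Integrable (fun ω => ∑ i, ∑ j, (Q t ω i j : ℝ) * (A t ω i j : ℝ)) P :=
      fun t => integrable_finsetSum _ fun i _ => integrable_finsetSum _ fun j _ =>
        hQAint t i j
    have hmono := integral_mono (μ := P)
      ((integrable_finsetSum (Finset.range T) fun t _ => hWint t).const_mul
        (1 - (1 - r) / 2))
      ((integrable_finsetSum (Finset.range T) fun t _ => hQAint2 t).add
        (integrable_const (C * ((T : ℝ) + 1))))
      (fun ω => hdrift (fun t' => A t' ω) (fun t' i j => hb t' ω i j) T)
    simp only [Pi.add_apply] at hmono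
    rw [integral_const_mul, integral_finsetSum _ fun t _ => hWint t,
      integral_add (integrable_finsetSum (Finset.range T) fun t _ => hQAint2 t)
        (integrable_const _), integral_finsetSum _ fun t _ => hQAint2 t, integral_const,
      probReal_univ, one_smul] at hmono
    have h1 := Finset.sum_le_sum fun t (_ : t ∈ Finset.range T) => hQA t
    rw [← Finset.mul_sum] at h1
    linarith
  set c : ℝ := ∑ i, ∑ j, (net.initQueue i j : ℝ) with hc
  have hc0 : 0 ≤ c := by positivity
  have h1r : 0 < (1 - r) / 2 := by linarith
  refine stronglyStable_of_sum_le (C := N * N * (C / ((1 - r) / 2)) + c) (by positivity)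
    (fun t => N * N * x t + c)
    (fun t => add_nonneg (mul_nonneg (by positivity) (hx0 t)) hc0) (fun t => ?_) fun T => ?_
  · have hae : ∀ᵐ ω ∂P, ((totalQueue (p.adaptive g) (fun t' => A t' ω) t : ℕ) : ℝ)
        ≤ N * N * (maxWeight net (Q t ω) : ℝ) + c := by
      have h1 : ∀ᵐ ω ∂P, ∀ i j, Q t ω i j ≤ maxWeight net (Q t ω) + net.initQueue i j :=
        ae_all_iff.2 fun i => ae_all_iff.2 fun j =>
          ae_queue_le_maxWeight_add hA (p.adaptive g) hr t i j
      filter_upwards [h1] with ω hω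
      have h2 : totalQueue (p.adaptive g) (fun t' => A t' ω) t
          ≤ ∑ i, ∑ j, (maxWeight net (Q t ω) + net.initQueue i j) :=
        Finset.sum_le_sum fun i _ => Finset.sum_le_sum fun j _ => hω i j
      have h3 : ((totalQueue (p.adaptive g) (fun t' => A t' ω) t : ℕ) : ℝ)
          ≤ ((∑ i, ∑ j, (maxWeight net (Q t ω) + net.initQueue i j) : ℕ) : ℝ) := by
        exact_mod_cast h2
      refine h3.trans (le_of_eq ?_)
      push_cast
      simp only [Finset.sum_add_distrib, Finset.sum_const, Finset.card_univ, Fintype.card_fin,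
        nsmul_eq_mul, hc]
      ring
    calc ∫⁻ ω, (totalQueue (p.adaptive g) (fun t' => A t' ω) t : ℝ≥0∞) ∂P
        ≤ ∫⁻ ω, ENNReal.ofReal (N * N * (maxWeight net (Q t ω) : ℝ) + c) ∂P := by
          refine lintegral_mono_ae ?_
          filter_upwards [hae] with ω hω
          rw [← ENNReal.ofReal_natCast]
          exact ENNReal.ofReal_le_ofReal hω
      _ = ENNReal.ofReal (∫ ω, (N * N * (maxWeight net (Q t ω) : ℝ) + c) ∂P) :=
          (ofReal_integral_eq_lintegral_ofReal
            (((hWint t).const_mul _).add (integrable_const _))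
            (Eventually.of_forall fun ω => add_nonneg (by positivity) hc0)).symm
      _ = _ := by
          rw [integral_add ((hWint t).const_mul _) (integrable_const _), integral_const_mul,
            integral_const, probReal_univ, one_smul]
  · rw [Finset.sum_add_distrib, ← Finset.mul_sum, Finset.sum_const, Finset.card_range,
      nsmul_eq_mul]
    have h1 : ∑ t ∈ Finset.range T, x t ≤ C / ((1 - r) / 2) * (T + 1) := by
      rw [div_mul_eq_mul_div, le_div_iff₀ h1r]
      linarith [hsum T]
    have h2 := mul_le_mul_of_nonneg_left h1 (show (0 : ℝ) ≤ N * N by positivity)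
    linarith

end Stability

/-! ### Throughput optimality and the power-law hysteresis. -/

theorem Policy.IsPipelinedMaxWeight.throughputOptimal_adaptive {N : ℕ} {net : Network N}
    {p : Policy net} {K : ℕ} (hp : p.IsPipelinedMaxWeight K) {g : ℝ → ℝ}
    (hg : IsHysteresis g) : ThroughputOptimal.{u} (p.adaptive g) := by
  rintro Ω _ P A hP hA ⟨Amax, hb⟩ - hload
  obtain ⟨r, hr0, hr1, hr⟩ := exists_sum_mul_le_of_load_lt_one hload
  exact hp.stronglyStable_adaptive hg hA hb hr1 hr0 hr

theorem isHysteresis_mul_rpow {b e : ℝ} (hb : 0 < b) (he0 : 0 < e) (he1 : e < 1) :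
    IsHysteresis fun x => b * x ^ e where
  nonneg x hx := mul_nonneg hb.le (Real.rpow_nonneg hx _)
  continuousOn := (continuous_const.mul (Real.continuous_rpow_const he0.le)).continuousOn
  strictMonoOn x hx y _ hxy := mul_lt_mul_of_pos_left (Real.rpow_lt_rpow hx hxy he0) hb
  sublinear := by
    have h := (tendsto_rpow_neg_atTop (sub_pos.2 he1)).const_mul b
    rw [mul_zero] at h
    refine h.congr' ?_
    filter_upwards [eventually_gt_atTop 0] with x hx
    rw [neg_sub, Real.rpow_sub_one hx.ne', mul_div_assoc]
  unbounded := (tendsto_rpow_atTop he0).const_mul_atTop hb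

end OpticalSwitch

open OpticalSwitch
theorem corollary1 {N : ℕ} (net : Network N) (hdelay : 0 < net.delay) :
    (∀ (p : Policy net) (γ δ : ℝ), γ ∈ Set.Ioo (0 : ℝ) 1 → δ ∈ Set.Ioo (0 : ℝ) 1 →
      p.IsMaxWeight →
        ThroughputOptimal.{u} (p.adaptive fun x => (1 - γ) * x ^ (1 - δ))) ∧
    (∀ (p : Policy net) (K : ℕ), p.IsPipelinedMaxWeight K →
      (∀ g : ℝ → ℝ, IsHysteresis g → ThroughputOptimal.{u} (p.adaptive g)) ∧
      (net.IsCrossbar →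
        ∀ Amax : ℕ, p.WeightGapAtMost Amax ((N : ℝ) * ((Amax : ℝ) + 1) * (K : ℝ)))) := by
  refine ⟨fun p γ δ hγ hδ hp => ?_, fun p K hp => ⟨fun g hg => ?_, fun h Amax => ?_⟩⟩
  -- MaxWeight is the pipelined policy with lag 0.
  · have hp0 : p.IsPipelinedMaxWeight 0 := fun t a s => hp t a s
    exact hp0.throughputOptimal_adaptive (isHysteresis_mul_rpow (sub_pos.2 hγ.2)
      (sub_pos.2 hδ.2) (by linarith [hδ.1]))
  · exact hp.throughputOptimal_adaptive hg
  -- A crossbar schedule has at most `N` ones, which replaces the general bound `N * N`.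
  · exact hp.weightGapAtMost h.sum_toNat_le Amax
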